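/- Let $\mu$ be a probability distribution on $\mathbb{R}$ that is non-degenerate (not a point mass) and has bounded non-negative support, i.e. $\mu((-\infty,0))=0$ and $\mu((-\infty,C])=1$ for some $C>0$. Let $0<\alpha<1/3$ and $1\le r<\infty$. For $n\ge 1$ put $m=\lfloor n^{\alpha}\rfloor$, attach i.i.d. random weights $w(v)$ with law $\mu$ to the vertices $v\in\{1,\dots,n\}\times\{1,\dots,m\}$, and let $$L_n=\max_{\pi}\sum_{v\in\pi}w(v)$$ be the directed last passage time, where the maximum is over all paths $\pi=(v_1,\dots,v_{n+m-1})$ with $v_1=(1,1)$, $v_{n+m-1}=(n,m)$ and $v_{i+1}-v_i\in\{(1,0),(0,1)\}$ for all $i$. Then there are a constant $c_0>0$ and an integer $N$, depending only on $r$, $\alpha$ and $\mu$, such that for every $n\ge N$ $$\mathbb{E}\,\bigl|L_n-\mathbb{E}L_n\bigr|^{r}\ \ge\ c_0\,n^{\frac{r(1-\alpha)}{2}}.$$ -/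

import Mathlib

open MeasureTheory ProbabilityTheory

noncomputable section

/-- The vertices of the `n × m` grid. The coordinates are counted from `0`, so that `(i, j)` is the
vertex usually written `(i + 1, j + 1)`. -/
abbrev Grid (n m : ℕ) : Type := Fin n × Fin m

/-- `π` is a unit-step up-right path in the `n × m` grid from the lower left corner to the upper
right corner: it has `n + m - 1` vertices, and each step adds `(1, 0)` or `(0, 1)`. -/
def IsDirectedPath (n m : ℕ) (π : Fin (n + m - 1) → Grid n m) : Prop :=
  (∀ k : Fin (n + m - 1), (k : ℕ) = 0 → ((π k).1 : ℕ) = 0 ∧ ((π k).2 : ℕ) = 0) ∧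
  (∀ k : Fin (n + m - 1), (k : ℕ) + 1 = n + m - 1 → ((π k).1 : ℕ) + 1 = n ∧ ((π k).2 : ℕ) + 1 = m) ∧
  (∀ k l : Fin (n + m - 1), (l : ℕ) = (k : ℕ) + 1 →
    (((π l).1 : ℕ) = ((π k).1 : ℕ) + 1 ∧ ((π l).2 : ℕ) = ((π k).2 : ℕ)) ∨
    (((π l).1 : ℕ) = ((π k).1 : ℕ) ∧ ((π l).2 : ℕ) = ((π k).2 : ℕ) + 1))

/-- The (finite) type of all directed paths in the `n × m` grid. -/
abbrev DirectedPath (n m : ℕ) : Type :=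
  {π : Fin (n + m - 1) → Grid n m // IsDirectedPath n m π}

/-- The last passage time of the weights `w` on the `n × m` grid: the maximum over all directed
paths of the sum of the weights along the path. For `1 ≤ n` and `1 ≤ m` this is the supremum over
a finite non-empty type. -/
def lastPassageTime {n m : ℕ} (w : Grid n m → ℝ) : ℝ :=
  ⨆ π : DirectedPath n m, ∑ k, w (π.1 k)

/-- The `r`-th (absolute) central moment `E |X - E X| ^ r` of a real random variable. -/
def absCentralMoment {Ω : Type*} [MeasurableSpace Ω] (X : Ω → ℝ) (r : ℝ) (P : Measure Ω) : ℝ :=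
  ∫ ω, |X ω - ∫ ω', X ω' ∂P| ^ r ∂P

end

/-!
The last passage time is compared with the one of slightly increased weights. Let `L` be the last
passage time of weights `w` on the `n × m` grid, where `m = ⌊n ^ α⌋`, and resample each weight
upwards: independently at each vertex and with probability `e = 1 / √(n * m)`, replace `w v` by the
maximum of `w v` and a fresh sample of `μ`. Because the weights are non-negative, this is
`max (w v) (z v)` with `z v` a fresh sample that is kept with probability `e` and replaced by `0`
otherwise (`thinnedLaw`). Two facts about the new weights `w'` carry the argument.

* The law of `w'` is comparable to that of `w` (`pi_mixture_apply_le`). The law of the maximum of two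
  samples has density at most `2` with respect to `μ`, so a single weight of `w'` has a density with
  second moment at most `1 + e ^ 2`, and the density of the whole configuration has second moment at
  most `(1 + e ^ 2) ^ (n * m) ≤ exp 1`. Hence an event that is unlikely for `w` is unlikely for `w'`.
* With high probability every path gains at least `e * γ * (n + m - 1) / 2`, for a constant `γ > 0`
  that exists because `μ` is non-degenerate (`exists_lintegral_exp_neg_gain_le`). This is a Chernoff
  bound for one path and a union bound over at most `(n + m) ^ m` paths
  (`measure_exists_path_sum_lt_le`, `card_directedPath_le`). The union bound succeeds since
  `m * log n` is negligible against `e * n ≈ n ^ ((1 - α) / 2)`, which is where `α < 1 / 3` enters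
  (`eventually_rpow_mul_log_add_le`). The last passage time then gains at least as much.

If `L` were within `t = γ * n ^ ((1 - α) / 2) / 4` of some number `a` with probability close to one,
then so would be the last passage time of `w'`, although the two differ by at least `2 * t` with high
probability. So `|L - a| ≥ t` has probability bounded below, for every `a`
(`measure_abs_lastPassageTime_sub_ge`), and Markov's inequality for `|L - 𝔼 L| ^ r` concludes.
-/

open scoped ENNReal

/-! ### Directed paths -/

section DirectedPaths

variable {n m : ℕ} {π : Fin (n + m - 1) → Grid n m}

lemma IsDirectedPath.fst_add_snd (hπ : IsDirectedPath n m π) (k : Fin (n + m - 1)) :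
    ((π k).1 : ℕ) + ((π k).2 : ℕ) = k := by
  obtain ⟨k, hk⟩ := k
  induction k with
  | zero => have := hπ.1 ⟨0, hk⟩ rfl; lia
  | succ k ih =>
    have h1 := ih (by lia)
    have h2 := hπ.2.2 ⟨k, by lia⟩ ⟨k + 1, hk⟩ rfl
    dsimp only at h1 h2 ⊢
    lia

lemma IsDirectedPath.injective (hπ : IsDirectedPath n m π) : Function.Injective π := by
  intro k l h
  have h1 := hπ.fst_add_snd k
  have h2 := hπ.fst_add_snd l
  rw [h] at h1
  exact Fin.ext (h1.symm.trans h2)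

lemma IsDirectedPath.snd_mono (hπ : IsDirectedPath n m π) {k l : Fin (n + m - 1)} (h : k ≤ l) :
    ((π k).2 : ℕ) ≤ (π l).2 := by
  obtain ⟨l, hl⟩ := l
  induction l with
  | zero =>
    have : k = ⟨0, hl⟩ := Fin.ext (Nat.le_zero.1 h)
    rw [this]
  | succ l ih =>
    rcases (Fin.le_def.1 h).eq_or_lt with h' | h'
    · have : k = ⟨l + 1, hl⟩ := Fin.ext h'
      rw [this]
    · have h1 := ih (by lia) (Fin.le_def.2 (Nat.lt_succ_iff.1 h'))
      have h2 := hπ.2.2 ⟨l, by lia⟩ ⟨l + 1, hl⟩ rfl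
      lia

/-- A directed path is determined by the numbers of its vertices in the lowest `j` rows, for `j < m`;
this gives a bound on the number of paths that is only polynomial in `n` for fixed `m`. -/
lemma card_directedPath_le (n m : ℕ) : Nat.card (DirectedPath n m) ≤ (n + m) ^ m := by
  classical
  rcases Nat.eq_zero_or_pos m with rfl | hm
  · have : Subsingleton (DirectedPath n 0) :=
      ⟨fun π _ => Subtype.ext (funext fun k => (π.1 k).2.elim0)⟩
    simpa using Finite.card_le_one_iff_subsingleton.2 this
  let below (π : DirectedPath n m) (j : Fin m) : Finset (Fin (n + m - 1)) :=
    Finset.univ.filter fun k => (π.1 k).2 < j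
  have hcard (π j) : (below π j).card < n + m := by
    have := Finset.card_le_univ (below π j)
    rw [Fintype.card_fin] at this
    lia
  let Φ (π : DirectedPath n m) (j : Fin m) : Fin (n + m) := ⟨(below π j).card, hcard π j⟩
  -- The set of times spent below a given row is an initial segment, hence determined by its size.
  have hlower (π : DirectedPath n m) (j : Fin m) :
      IsLowerSet (below π j : Set (Fin (n + m - 1))) := by
    intro k l hlk hk
    simp only [below, Finset.coe_filter, Finset.mem_univ, true_and, Set.mem_ofPred_eq] at hk ⊢
    have := π.2.snd_mono hlk
    lia
  have hΦ : Function.Injective Φ := by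
    intro π σ h
    have hbelow (j : Fin m) : below π j = below σ j := by
      have hj : (below π j).card = (below σ j).card := congrArg Fin.val (congrFun h j)
      rcases (hlower π j).total (hlower σ j) with hs | hs
      · exact Finset.eq_of_subset_of_card_le (Finset.coe_subset.1 hs) hj.ge
      · exact (Finset.eq_of_subset_of_card_le (Finset.coe_subset.1 hs) hj.le).symm
    have hmem (j : Fin m) (k) : (π.1 k).2 < j ↔ (σ.1 k).2 < j := by
      simpa [below] using Finset.ext_iff.1 (hbelow j) k
    refine Subtype.ext (funext fun k => ?_)
    have h2 : (π.1 k).2 = (σ.1 k).2 := by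
      rcases lt_trichotomy (π.1 k).2 (σ.1 k).2 with hlt | heq | hlt
      · exact absurd ((hmem _ k).1 hlt) (lt_irrefl _)
      · exact heq
      · exact absurd ((hmem _ k).2 hlt) (lt_irrefl _)
    have h1 := π.2.fst_add_snd k
    have h1' := σ.2.fst_add_snd k
    rw [h2] at h1
    exact Prod.ext (Fin.ext (by lia)) h2
  calc Nat.card (DirectedPath n m) ≤ Nat.card (Fin m → Fin (n + m)) :=
        Nat.card_le_card_of_injective Φ hΦ
    _ = (n + m) ^ m := by simp

/-- The path along the bottom row and then up the last column. -/
lemma nonempty_directedPath {n m : ℕ} (hn : 1 ≤ n) (hm : 1 ≤ m) : Nonempty (DirectedPath n m) := by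
  refine ⟨⟨fun k => (⟨min k (n - 1), by lia⟩, ⟨k - (n - 1), by lia⟩), ?_, ?_, ?_⟩⟩ <;>
    intro k <;> dsimp only <;> lia

lemma measurable_lastPassageTime (n m : ℕ) :
    Measurable (lastPassageTime : (Grid n m → ℝ) → ℝ) :=
  Measurable.iSup fun _ => Finset.measurable_fun_sum _ fun _ _ => measurable_pi_apply _

lemma sum_le_lastPassageTime (w : Grid n m → ℝ) (π : DirectedPath n m) :
    ∑ k, w (π.1 k) ≤ lastPassageTime w :=
  le_ciSup (f := fun π : DirectedPath n m => ∑ k, w (π.1 k)) (Set.finite_range _).bddAbove π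

/-- If the weights increase by at least `b` in total along every path, so does the last passage
time. -/
lemma lastPassageTime_add_le (hn : 1 ≤ n) (hm : 1 ≤ m) {w w' : Grid n m → ℝ} {b : ℝ}
    (h : ∀ π : DirectedPath n m, b ≤ ∑ k, (w' (π.1 k) - w (π.1 k))) :
    lastPassageTime w + b ≤ lastPassageTime w' := by
  have := nonempty_directedPath hn hm
  rw [← le_sub_iff_add_le]
  refine ciSup_le fun π => ?_
  have h1 := h π
  rw [Finset.sum_sub_distrib] at h1
  linarith [sum_le_lastPassageTime w' π]

lemma abs_lastPassageTime_le (hn : 1 ≤ n) (hm : 1 ≤ m) {w : Grid n m → ℝ} {C : ℝ}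
    (h : ∀ v, |w v| ≤ C) : |lastPassageTime w| ≤ (n + m - 1 : ℕ) * C := by
  obtain ⟨π₀⟩ := nonempty_directedPath hn hm
  have hsum (π : DirectedPath n m) : |∑ k, w (π.1 k)| ≤ (n + m - 1 : ℕ) * C := by
    refine (Finset.abs_sum_le_sum_abs _ _).trans ?_
    refine (Finset.sum_le_sum fun k _ => h (π.1 k)).trans ?_
    simp
  have : Nonempty (DirectedPath n m) := ⟨π₀⟩
  exact abs_le.2 ⟨(abs_le.1 (hsum π₀)).1.trans (sum_le_lastPassageTime w π₀),
    ciSup_le fun π => (abs_le.1 (hsum π)).2⟩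

end DirectedPaths

/-! ### Product measures -/

section ProductMeasures

variable {ι X : Type*} [Fintype ι] [MeasurableSpace X]

lemma lintegral_pi_prod_comp {κ : Type*} [Fintype κ] (μ : Measure X) [IsProbabilityMeasure μ]
    {g : κ → ι} (hg : Function.Injective g) {f : κ → X → ℝ≥0∞} (hf : ∀ k, Measurable (f k)) :
    ∫⁻ x, ∏ k, f k (x (g k)) ∂(Measure.pi fun _ : ι => μ) = ∏ k, ∫⁻ y, f k y ∂μ := by
  have hind : iIndepFun (fun i (x : ι → X) => x i) (Measure.pi fun _ : ι => μ) :=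
    iIndepFun_pi (X := fun _ => id) fun _ => aemeasurable_id
  rw [lintegral_prod_eq_prod_lintegral_of_indepFun Finset.univ (fun k (x : ι → X) => f k (x (g k)))
    ((hind.precomp hg).comp f hf) fun k => (hf k).comp (measurable_pi_apply _)]
  refine Finset.prod_congr rfl fun k _ => ?_
  exact (measurePreserving_eval (fun _ : ι => μ) (g k)).lintegral_comp (hf k)

lemma lintegral_pi_prod (μ : Measure X) [IsProbabilityMeasure μ] {f : ι → X → ℝ≥0∞}
    (hf : ∀ i, Measurable (f i)) :
    ∫⁻ x, ∏ i, f i (x i) ∂(Measure.pi fun _ : ι => μ) = ∏ i, ∫⁻ y, f i y ∂μ :=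
  lintegral_pi_prod_comp μ Function.injective_id hf

/-- Density of a product of identical laws. -/
lemma pi_withDensity (μ : Measure X) [IsProbabilityMeasure μ] {f : X → ℝ≥0∞} (hf : Measurable f)
    [IsProbabilityMeasure (μ.withDensity f)] :
    Measure.pi (fun _ : ι => μ.withDensity f) =
      (Measure.pi fun _ : ι => μ).withDensity fun x => ∏ i, f (x i) := by
  refine Measure.pi_eq fun s hs => ?_
  rw [withDensity_apply _ (MeasurableSet.univ_pi hs),
    ← lintegral_indicator (MeasurableSet.univ_pi hs)]
  have : (Set.univ.pi s).indicator (fun x : ι → X => ∏ i, f (x i)) =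
      fun x => ∏ i, (s i).indicator f (x i) := by
    funext x
    by_cases hx : ∀ i, x i ∈ s i
    · rw [Set.indicator_of_mem (by simpa [Set.mem_univ_pi] using hx)]
      exact Finset.prod_congr rfl fun i _ => (Set.indicator_of_mem (hx i) f).symm
    · rw [Set.indicator_of_notMem (by simpa [Set.mem_univ_pi] using hx)]
      push Not at hx
      obtain ⟨i, hi⟩ := hx
      exact (Finset.prod_eq_zero (Finset.mem_univ i) (Set.indicator_of_notMem hi f)).symm
  rw [this, lintegral_pi_prod μ fun i => hf.indicator (hs i)]
  exact Finset.prod_congr rfl fun i _ => by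
    rw [lintegral_indicator (hs i), withDensity_apply _ (hs i)]

/-- Quantitative absolute continuity: a density that is bounded in `L²` transfers smallness of
probabilities. -/
lemma withDensity_apply_le (P : Measure X) {D : X → ℝ≥0∞} (hD : Measurable D)
    {K : ℝ≥0∞} (hK0 : K ≠ 0) (hK : K ≠ ∞) {A : Set X} (hA : MeasurableSet A) :
    P.withDensity D A ≤ K * P A + (∫⁻ x, D x ^ 2 ∂P) / K := by
  have hpt (x : X) : D x ≤ K + D x ^ 2 / K := by
    rcases le_total (D x) K with h | h
    · exact h.trans le_self_add
    · refine le_add_left ?_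
      rw [ENNReal.le_div_iff_mul_le (.inl hK0) (.inl hK), sq]
      gcongr
  calc P.withDensity D A = ∫⁻ x in A, D x ∂P := withDensity_apply _ hA
    _ ≤ ∫⁻ x in A, (K + D x ^ 2 / K) ∂P := lintegral_mono fun x => hpt x
    _ = K * P A + (∫⁻ x in A, D x ^ 2 ∂P) / K := by
      rw [lintegral_add_left measurable_const, setLIntegral_const]
      simp_rw [div_eq_mul_inv]
      rw [lintegral_mul_const _ (hD.pow_const 2)]
    _ ≤ K * P A + (∫⁻ x, D x ^ 2 ∂P) / K := by
      gcongr
      exact Measure.restrict_le_self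

/-- Mixing a small proportion `b` of a law dominated by `2 • μ` into `μ` changes the product law of
`d` coordinates in a controlled way as long as `b ^ 2 * d` stays bounded. -/
lemma pi_mixture_apply_le (μ σ : Measure X) [IsProbabilityMeasure μ] [IsProbabilityMeasure σ]
    (hσ : ∀ s, MeasurableSet s → σ s ≤ 2 * μ s) {a b : ℝ≥0∞} (hab : a + b = 1)
    {K : ℝ≥0∞} (hK0 : K ≠ 0) (hK : K ≠ ∞) {A : Set (ι → X)} (hA : MeasurableSet A) :
    Measure.pi (fun _ : ι => a • μ + b • σ) A ≤
      K * Measure.pi (fun _ : ι => μ) A + (1 + b ^ 2) ^ Fintype.card ι / K := by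
  set h := σ.rnDeriv μ
  have hmeas : Measurable h := Measure.measurable_rnDeriv σ μ
  have hac : σ ≪ μ := by
    refine Measure.AbsolutelyContinuous.mk fun s hs h0 => ?_
    simpa [h0] using hσ s hs
  have hσh : μ.withDensity h = σ := Measure.withDensity_rnDeriv_eq σ μ hac
  have hint : ∫⁻ x, h x ∂μ = 1 := by
    rw [← setLIntegral_univ, ← withDensity_apply _ MeasurableSet.univ, hσh, measure_univ]
  have hle : h ≤ᵐ[μ] fun _ => 2 := by
    refine ae_le_of_forall_setLIntegral_le_of_sigmaFinite hmeas fun s hs _ => ?_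
    rw [← withDensity_apply _ hs, hσh, setLIntegral_const]
    exact hσ s hs
  let f : X → ℝ≥0∞ := fun x => a + b * h x
  have hf : Measurable f := (hmeas.const_mul b).const_add a
  have hmix : a • μ + b • σ = μ.withDensity f := by
    ext s hs
    rw [withDensity_apply _ hs, lintegral_add_left measurable_const, setLIntegral_const,
      lintegral_const_mul _ hmeas, ← withDensity_apply _ hs, hσh]
    simp
  have hprob : IsProbabilityMeasure (μ.withDensity f) := by
    rw [← hmix]
    exact ⟨by simp [hab]⟩
  have hsq : ∫⁻ x, f x ^ 2 ∂μ ≤ 1 + b ^ 2 := by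
    calc ∫⁻ x, f x ^ 2 ∂μ ≤ ∫⁻ x, (a ^ 2 + (2 * a * b + 2 * b ^ 2) * h x) ∂μ := by
          refine lintegral_mono_ae (hle.mono fun x hx => ?_)
          calc f x ^ 2 = a ^ 2 + 2 * a * b * h x + b ^ 2 * (h x * h x) := by ring
            _ ≤ a ^ 2 + 2 * a * b * h x + b ^ 2 * (2 * h x) := by gcongr
            _ = a ^ 2 + (2 * a * b + 2 * b ^ 2) * h x := by ring
      _ = a ^ 2 + (2 * a * b + 2 * b ^ 2) := by
          rw [lintegral_add_left measurable_const, lintegral_const_mul _ hmeas, hint]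
          simp
      _ = (a + b) ^ 2 + b ^ 2 := by ring
      _ = 1 + b ^ 2 := by rw [hab, one_pow]
  rw [hmix, pi_withDensity μ hf]
  refine (withDensity_apply_le _ (Finset.measurable_fun_prod _ fun i _ =>
    hf.comp (measurable_pi_apply i)) hK0 hK hA).trans ?_
  gcongr
  simp only [Function.comp_def, ← Finset.prod_pow]
  rw [lintegral_pi_prod μ fun _ => hf.pow_const 2, Finset.prod_const, Finset.card_univ]
  gcongr

end ProductMeasures

/-! ### A union bound over all paths -/

/-- Chernoff bound for the sum of independent variables along one path, summed over all paths. -/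
lemma measure_exists_path_sum_lt_le {X : Type*} [MeasurableSpace X] (ρ : Measure X)
    [IsProbabilityMeasure ρ] {Y : X → ℝ} (hY : Measurable Y) (n m : ℕ) (c : ℝ) :
    Measure.pi (fun _ : Grid n m => ρ)
        {ω | ∃ π : DirectedPath n m, ∑ k, Y (ω (π.1 k)) < c} ≤
      Nat.card (DirectedPath n m) * (ENNReal.ofReal (Real.exp c) *
        (∫⁻ y, ENNReal.ofReal (Real.exp (-Y y)) ∂ρ) ^ (n + m - 1)) := by
  classical
  have hφ : Measurable fun y => ENNReal.ofReal (Real.exp (-Y y)) := by fun_prop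
  have hpath (π : DirectedPath n m) : Measure.pi (fun _ : Grid n m => ρ)
      {ω | ∑ k, Y (ω (π.1 k)) < c} ≤ ENNReal.ofReal (Real.exp c) *
        (∫⁻ y, ENNReal.ofReal (Real.exp (-Y y)) ∂ρ) ^ (n + m - 1) := by
    have hprod (ω : Grid n m → X) : ENNReal.ofReal (Real.exp (c - ∑ k, Y (ω (π.1 k)))) =
        ENNReal.ofReal (Real.exp c) * ∏ k, ENNReal.ofReal (Real.exp (-Y (ω (π.1 k)))) := by
      rw [← ENNReal.ofReal_prod_of_nonneg fun _ _ => (Real.exp_pos _).le,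
        ← ENNReal.ofReal_mul (Real.exp_pos _).le, ← Real.exp_sum, ← Real.exp_add,
        Finset.sum_neg_distrib, sub_eq_add_neg]
    have hmeas : Measurable fun ω : Grid n m → X =>
        ∏ k, ENNReal.ofReal (Real.exp (-Y (ω (π.1 k)))) :=
      Finset.measurable_fun_prod _ fun k _ => hφ.comp (measurable_pi_apply _)
    calc Measure.pi (fun _ : Grid n m => ρ) {ω | ∑ k, Y (ω (π.1 k)) < c}
        ≤ 1 * Measure.pi (fun _ : Grid n m => ρ)
            {ω | 1 ≤ ENNReal.ofReal (Real.exp (c - ∑ k, Y (ω (π.1 k))))} := by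
          rw [one_mul]
          refine measure_mono fun ω hω => ?_
          have hω : ∑ k, Y (ω (π.1 k)) < c := hω
          change 1 ≤ ENNReal.ofReal _
          rw [ENNReal.one_le_ofReal]
          exact Real.one_le_exp (by linarith)
      _ ≤ ∫⁻ ω, ENNReal.ofReal (Real.exp (c - ∑ k, Y (ω (π.1 k))))
            ∂(Measure.pi fun _ : Grid n m => ρ) := by
          refine mul_meas_ge_le_lintegral ?_ 1
          simp_rw [hprod]
          exact hmeas.const_mul _
      _ = _ := by
          simp_rw [hprod]
          rw [lintegral_const_mul _ hmeas,
            lintegral_pi_prod_comp ρ π.2.injective fun _ => hφ, Finset.prod_const,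
            Finset.card_univ, Fintype.card_fin]
  have hset : {ω : Grid n m → X | ∃ π : DirectedPath n m, ∑ k, Y (ω (π.1 k)) < c} =
      ⋃ π : DirectedPath n m, {ω | ∑ k, Y (ω (π.1 k)) < c} := by
    ext ω
    simp
  have := Fintype.ofFinite (DirectedPath n m)
  rw [hset]
  refine (measure_iUnion_fintype_le _ _).trans ((Finset.sum_le_sum fun π _ => hpath π).trans ?_)
  rw [Finset.sum_const, Finset.card_univ, nsmul_eq_mul, Nat.card_eq_fintype_card]

/-! ### Resampling a weight upwards -/

section Resampling

variable (μ : Measure ℝ) [IsProbabilityMeasure μ]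

/-- For independent samples `x, y` of a non-degenerate law, replacing `x` by `max x y` is a strict
increase with positive probability. -/
lemma exists_lintegral_exp_neg_gain_le (hnondeg : ∀ a : ℝ, μ ≠ Measure.dirac a) :
    ∃ γ : ℝ, 0 < γ ∧ γ ≤ 1 ∧
      ∫⁻ p : ℝ × ℝ, ENNReal.ofReal (Real.exp (-(max p.1 p.2 - p.1))) ∂(μ.prod μ) ≤
        ENNReal.ofReal (1 - γ) := by
  set φ : ℝ × ℝ → ℝ≥0∞ := fun p => ENNReal.ofReal (Real.exp (-(max p.1 p.2 - p.1))) with hφ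
  have hmeas : Measurable φ := by fun_prop
  have hle1 (p) : φ p ≤ 1 := by
    rw [hφ, ENNReal.ofReal_le_one]
    exact Real.exp_le_one_iff.2 (by linarith [le_max_left p.1 p.2])
  have hint : ∫⁻ p, φ p ∂(μ.prod μ) ≤ 1 := by
    simpa using lintegral_mono (μ := μ.prod μ) hle1
  have hlt : ∫⁻ p, φ p ∂(μ.prod μ) < 1 := by
    refine hint.lt_of_ne fun heq => ?_
    have hae : φ =ᵐ[μ.prod μ] fun _ => 1 :=
      ae_eq_of_ae_le_of_lintegral_le (.of_forall hle1) (by simp [heq]) aemeasurable_const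
        (by simp [heq])
    have h1 : ∀ᵐ p ∂(μ.prod μ), p.2 ≤ p.1 := by
      filter_upwards [hae] with p hp
      rw [hφ] at hp
      dsimp only at hp
      rw [ENNReal.ofReal_eq_one, Real.exp_eq_one_iff] at hp
      linarith [le_max_right p.1 p.2]
    have h2 : ∀ᵐ p ∂(μ.prod μ), p.1 ≤ p.2 := by
      have := (Measure.measurePreserving_swap (μ := μ) (ν := μ)).quasiMeasurePreserving.ae h1
      simpa using this
    have h3 : ∀ᵐ x ∂μ, ∀ᵐ y ∂μ, y = x := by
      have heq : ∀ᵐ p ∂(μ.prod μ), p.2 = p.1 := by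
        filter_upwards [h1, h2] with p hp1 hp2 using le_antisymm hp1 hp2
      exact Measure.ae_ae_of_ae_prod heq
    obtain ⟨x, hx⟩ := h3.exists
    refine hnondeg x ?_
    calc μ = μ.map id := Measure.map_id.symm
      _ = μ.map fun _ => x := Measure.map_congr hx
      _ = Measure.dirac x := by simp [Measure.map_const]
  refine ⟨1 - (∫⁻ p, φ p ∂(μ.prod μ)).toReal, ?_, ?_, ?_⟩
  · rw [sub_pos, ← ENNReal.toReal_one]
    exact (ENNReal.toReal_lt_toReal hlt.ne_top ENNReal.one_ne_top).2 hlt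
  · linarith [ENNReal.toReal_nonneg (a := ∫⁻ p, φ p ∂(μ.prod μ))]
  · rw [sub_sub_cancel, ENNReal.ofReal_toReal hlt.ne_top]

/-- The law of a fresh sample of `μ` that is kept with probability `e` and replaced by `0`
otherwise. -/
noncomputable def thinnedLaw (e : ℝ) : Measure ℝ :=
  ENNReal.ofReal (1 - e) • Measure.dirac 0 + ENNReal.ofReal e • μ

lemma ofReal_one_sub_add_ofReal {e : ℝ} (he0 : 0 ≤ e) (he1 : e ≤ 1) :
    ENNReal.ofReal (1 - e) + ENNReal.ofReal e = 1 := by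
  rw [← ENNReal.ofReal_add (by linarith) he0, sub_add_cancel, ENNReal.ofReal_one]

lemma isProbabilityMeasure_thinnedLaw {e : ℝ} (he0 : 0 ≤ e) (he1 : e ≤ 1) :
    IsProbabilityMeasure (thinnedLaw μ e) :=
  ⟨by simp [thinnedLaw, ofReal_one_sub_add_ofReal he0 he1]⟩

instance (e : ℝ) : IsFiniteMeasure (thinnedLaw μ e) :=
  ⟨by simp [thinnedLaw, ENNReal.ofReal_lt_top]⟩

lemma prod_thinnedLaw (e : ℝ) : μ.prod (thinnedLaw μ e) =
    ENNReal.ofReal (1 - e) • μ.prod (Measure.dirac 0) + ENNReal.ofReal e • μ.prod μ := by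
  have : IsFiniteMeasure (ENNReal.ofReal (1 - e) • Measure.dirac (0 : ℝ)) :=
    ⟨by simp [ENNReal.ofReal_lt_top]⟩
  have : IsFiniteMeasure (ENNReal.ofReal e • μ) := ⟨by simp [ENNReal.ofReal_lt_top]⟩
  rw [thinnedLaw, Measure.prod_add, Measure.prod_smul_right, Measure.prod_smul_right]

lemma map_max_prod_thinnedLaw (hnonneg : μ (Set.Iio 0) = 0) (e : ℝ) :
    (μ.prod (thinnedLaw μ e)).map (fun p => max p.1 p.2) =
      ENNReal.ofReal (1 - e) • μ +
        ENNReal.ofReal e • (μ.prod μ).map fun p => max p.1 p.2 := by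
  have hmax : Measurable fun p : ℝ × ℝ => max p.1 p.2 := by fun_prop
  have h0 : ∀ᵐ x ∂μ, 0 ≤ x := by
    rw [ae_iff]
    simpa [Set.Iio] using hnonneg
  have hdirac : (μ.prod (Measure.dirac 0)).map (fun p => max p.1 p.2) = μ := by
    rw [Measure.prod_dirac, Measure.map_map hmax (by fun_prop)]
    calc _ = μ.map id := Measure.map_congr (h0.mono fun x hx => max_eq_left hx)
      _ = μ := Measure.map_id
  rw [prod_thinnedLaw, Measure.map_add _ _ hmax, Measure.map_smul, Measure.map_smul, hdirac]

lemma map_max_prod_apply_le {s : Set ℝ} (hs : MeasurableSet s) :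
    (μ.prod μ).map (fun p => max p.1 p.2) s ≤ 2 * μ s := by
  rw [Measure.map_apply (by fun_prop) hs]
  calc (μ.prod μ) ((fun p : ℝ × ℝ => max p.1 p.2) ⁻¹' s)
      ≤ (μ.prod μ) (s ×ˢ Set.univ ∪ Set.univ ×ˢ s) := by
        refine measure_mono fun p hp => ?_
        have hp : max p.1 p.2 ∈ s := hp
        rcases max_choice p.1 p.2 with h | h <;> rw [h] at hp
        · exact .inl ⟨hp, trivial⟩
        · exact .inr ⟨trivial, hp⟩
    _ ≤ (μ.prod μ) (s ×ˢ Set.univ) + (μ.prod μ) (Set.univ ×ˢ s) := measure_union_le _ _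
    _ = 2 * μ s := by simp [two_mul]

lemma lintegral_exp_neg_gain_thinnedLaw_le {e γ : ℝ} (he0 : 0 ≤ e) (he1 : e ≤ 1) (hγ1 : γ ≤ 1)
    (hγ : ∫⁻ p : ℝ × ℝ, ENNReal.ofReal (Real.exp (-(max p.1 p.2 - p.1))) ∂(μ.prod μ) ≤
      ENNReal.ofReal (1 - γ)) :
    ∫⁻ p : ℝ × ℝ, ENNReal.ofReal (Real.exp (-(max p.1 p.2 - p.1))) ∂(μ.prod (thinnedLaw μ e)) ≤
      ENNReal.ofReal (1 - e * γ) := by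
  have hle1 : ∫⁻ p : ℝ × ℝ, ENNReal.ofReal (Real.exp (-(max p.1 p.2 - p.1)))
      ∂(μ.prod (Measure.dirac 0)) ≤ 1 := by
    calc _ ≤ ∫⁻ _ : ℝ × ℝ, 1 ∂(μ.prod (Measure.dirac 0)) := by
          refine lintegral_mono fun p => ?_
          rw [ENNReal.ofReal_le_one]
          exact Real.exp_le_one_iff.2 (by linarith [le_max_left p.1 p.2])
      _ = 1 := by simp
  rw [prod_thinnedLaw, lintegral_add_measure, lintegral_smul_measure, lintegral_smul_measure,
    smul_eq_mul, smul_eq_mul]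
  calc _ ≤ ENNReal.ofReal (1 - e) * 1 + ENNReal.ofReal e * ENNReal.ofReal (1 - γ) := by gcongr
    _ = ENNReal.ofReal (1 - e * γ) := by
      rw [mul_one, ← ENNReal.ofReal_mul he0,
        ← ENNReal.ofReal_add (by linarith) (mul_nonneg he0 (by linarith))]
      congr 1
      ring

end Resampling

/-! ### Fluctuations on a fixed grid -/

/-- Coupling `w` with its upward perturbation `max w z` shows that the last passage time cannot be
concentrated in a window of width `2 * t` when the perturbation raises every path by at least that
with high probability, yet the law of `max w z` stays comparable to that of `w`. -/
lemma measure_abs_lastPassageTime_sub_ge (μ : Measure ℝ) [IsProbabilityMeasure μ]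
    (hnonneg : μ (Set.Iio 0) = 0) {γ : ℝ} (hγ0 : 0 < γ) (hγ1 : γ ≤ 1)
    (hγ : ∫⁻ p : ℝ × ℝ, ENNReal.ofReal (Real.exp (-(max p.1 p.2 - p.1))) ∂(μ.prod μ) ≤
      ENNReal.ofReal (1 - γ))
    {n m : ℕ} (hn : 1 ≤ n) (hm : 1 ≤ m) {e : ℝ} (he0 : 0 ≤ e) (he1 : e ≤ 1)
    (he2 : e ^ 2 * (n * m : ℕ) ≤ 1)
    (hpaths : ((n + m : ℕ) : ℝ) ^ m * Real.exp (-(e * γ * (n + m - 1 : ℕ) / 2)) ≤ 1 / 8)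
    {t : ℝ} (ht : 4 * t ≤ e * γ * (n + m - 1 : ℕ)) (a : ℝ) :
    1 / 40 ≤ (Measure.pi fun _ : Grid n m => μ).real {w | t ≤ |lastPassageTime w - a|} := by
  set N : ℕ := n + m - 1
  have := isProbabilityMeasure_thinnedLaw μ he0 he1
  set ρ := μ.prod (thinnedLaw μ e) with hρ
  set Q := Measure.pi fun _ : Grid n m => μ with hQ
  set T := Measure.pi fun _ : Grid n m => ρ with hT
  set A := {w : Grid n m → ℝ | t ≤ |lastPassageTime w - a|}
  have hmaxm : Measurable fun p : ℝ × ℝ => max p.1 p.2 := by fun_prop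
  have hAm : MeasurableSet A :=
    measurableSet_le measurable_const ((measurable_lastPassageTime n m).sub_const a).abs
  have hfst : T.map (fun ω v => (ω v).1) = Q := by
    rw [hT, Measure.pi_map_pi (f := fun _ => Prod.fst) fun _ => measurable_fst.aemeasurable]
    simp [hρ, hQ, Measure.map_fst_prod]
  have : IsProbabilityMeasure ((μ.prod μ).map fun p => max p.1 p.2) :=
    Measure.isProbabilityMeasure_map hmaxm.aemeasurable
  have hmax : T.map (fun ω v => max (ω v).1 (ω v).2) = Measure.pi fun _ : Grid n m =>
      ENNReal.ofReal (1 - e) • μ + ENNReal.ofReal e • (μ.prod μ).map fun p => max p.1 p.2 := by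
    rw [hT, Measure.pi_map_pi (f := fun _ (p : ℝ × ℝ) => max p.1 p.2)
      fun _ => hmaxm.aemeasurable]
    simp_rw [hρ, map_max_prod_thinnedLaw μ hnonneg e]
  set A₁ := (fun (ω : Grid n m → ℝ × ℝ) v => (ω v).1) ⁻¹' A
  set A₂ := (fun (ω : Grid n m → ℝ × ℝ) v => max (ω v).1 (ω v).2) ⁻¹' A with hA₂
  set B := {ω : Grid n m → ℝ × ℝ | ∃ π : DirectedPath n m,
    ∑ k, (max (ω (π.1 k)).1 (ω (π.1 k)).2 - (ω (π.1 k)).1) < e * γ * N / 2}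
  have hPA₁ : T A₁ = Q A := by
    rw [← hfst, Measure.map_apply (by fun_prop) hAm]
  -- The constant `24` makes the second-moment term `3 / 24` small: together with the `1 / 8` for `B`
  -- it must stay below `1`.
  have hPA₂ : T A₂ ≤ 24 * Q A + 1 / 8 := by
    rw [hA₂, ← Measure.map_apply (by fun_prop) hAm, hmax]
    refine (pi_mixture_apply_le μ _ (fun s hs => map_max_prod_apply_le μ hs)
      (ofReal_one_sub_add_ofReal he0 he1) (K := 24) (by norm_num) (by norm_num) hAm).trans (add_le_add le_rfl ?_)
    have h3 : (1 + ENNReal.ofReal e ^ 2) ^ Fintype.card (Grid n m) ≤ 3 := by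
      rw [← ENNReal.ofReal_pow he0, ← ENNReal.ofReal_one, ← ENNReal.ofReal_add zero_le_one
        (sq_nonneg e), ← ENNReal.ofReal_pow (by positivity), ← ENNReal.ofReal_ofNat 3]
      refine ENNReal.ofReal_le_ofReal ?_
      calc (1 + e ^ 2) ^ Fintype.card (Grid n m)
          ≤ Real.exp (e ^ 2) ^ Fintype.card (Grid n m) := by
            gcongr
            linarith [Real.add_one_le_exp (e ^ 2)]
        _ = Real.exp (e ^ 2 * (n * m : ℕ)) := by
            rw [← Real.exp_nat_mul, Fintype.card_prod, Fintype.card_fin, Fintype.card_fin,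
              mul_comm]
        _ ≤ Real.exp 1 := Real.exp_le_exp.2 he2
        _ ≤ 3 := by linarith [Real.exp_one_lt_d9]
    calc _ ≤ (3 : ℝ≥0∞) / 24 := by gcongr
      _ = 1 / 8 := by
        rw [ENNReal.div_eq_div_iff (by norm_num) (by norm_num) (by norm_num) (by norm_num)]
        norm_num
  have hPB : T B ≤ 1 / 8 := by
    have heγ : 0 ≤ 1 - e * γ := by nlinarith
    refine (measure_exists_path_sum_lt_le ρ (Y := fun p => max p.1 p.2 - p.1) (by fun_prop)
      n m _).trans ?_
    calc _ ≤ ((n + m : ℕ) : ℝ≥0∞) ^ m * (ENNReal.ofReal (Real.exp (e * γ * N / 2)) *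
          ENNReal.ofReal (1 - e * γ) ^ N) := by
          gcongr
          · exact_mod_cast card_directedPath_le n m
          · exact lintegral_exp_neg_gain_thinnedLaw_le μ he0 he1 hγ1 hγ
      _ = ENNReal.ofReal (((n + m : ℕ) : ℝ) ^ m *
          (Real.exp (e * γ * N / 2) * (1 - e * γ) ^ N)) := by
          rw [ENNReal.ofReal_mul (by positivity), ENNReal.ofReal_mul (by positivity),
            ENNReal.ofReal_pow (by positivity), ENNReal.ofReal_pow heγ, ENNReal.ofReal_natCast]
      _ ≤ ENNReal.ofReal (1 / 8) := by
          refine ENNReal.ofReal_le_ofReal (le_trans ?_ hpaths)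
          gcongr
          calc Real.exp (e * γ * N / 2) * (1 - e * γ) ^ N
              ≤ Real.exp (e * γ * N / 2) * Real.exp (-(e * γ)) ^ N := by
                gcongr
                linarith [Real.add_one_le_exp (-(e * γ))]
            _ = Real.exp (-(e * γ * N / 2)) := by
                rw [← Real.exp_nat_mul, ← Real.exp_add]
                congr 1
                ring
      _ = 1 / 8 := by
          rw [ENNReal.ofReal_div_of_pos (by norm_num)]
          simp
  -- Otherwise both passage times lie within `t` of `a`, although they differ by at least `2 * t`.
  have hcover : (Set.univ : Set (Grid n m → ℝ × ℝ)) ⊆ A₁ ∪ A₂ ∪ B := by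
    intro ω _
    by_contra hω
    simp only [Set.mem_union, not_or] at hω
    obtain ⟨⟨h1, h2⟩, h3⟩ := hω
    have h1 : ¬ t ≤ |lastPassageTime (fun v => (ω v).1) - a| := h1
    have h2 : ¬ t ≤ |lastPassageTime (fun v => max (ω v).1 (ω v).2) - a| := h2
    have h3 : ¬ ∃ π : DirectedPath n m,
      ∑ k, (max (ω (π.1 k)).1 (ω (π.1 k)).2 - (ω (π.1 k)).1) < e * γ * N / 2 := h3
    push Not at h1 h2 h3
    have := lastPassageTime_add_le hn hm (w := fun v => (ω v).1)
      (w' := fun v => max (ω v).1 (ω v).2) h3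
    linarith [(abs_lt.1 h1).1, (abs_lt.1 h2).2]
  have htotal : 1 ≤ Q A + (24 * Q A + 1 / 8) + 1 / 8 := by
    calc (1 : ℝ≥0∞) = T Set.univ := measure_univ.symm
      _ ≤ T (A₁ ∪ A₂ ∪ B) := measure_mono hcover
      _ ≤ T A₁ + T A₂ + T B := (measure_union_le _ _).trans (by gcongr; exact measure_union_le _ _)
      _ ≤ _ := by rw [hPA₁]; gcongr
  have hreal : (1 : ℝ) ≤ Q.real A + (24 * Q.real A + 1 / 8) + 1 / 8 := by
    have h8 : (1 / 8 : ℝ≥0∞) = ENNReal.ofReal (1 / 8) := by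
      rw [ENNReal.ofReal_div_of_pos (by norm_num)]
      simp
    rw [← ofReal_measureReal (μ := Q) (s := A), h8, ← ENNReal.ofReal_ofNat 24,
      ← ENNReal.ofReal_mul (by norm_num), ← ENNReal.ofReal_add (by positivity) (by norm_num),
      ← ENNReal.ofReal_add (by positivity) (by positivity),
      ← ENNReal.ofReal_add (by positivity) (by norm_num), ENNReal.one_le_ofReal] at htotal
    exact htotal
  linarith

/-- The number of paths, at most `(2 * n) ^ (n ^ α)`, is negligible against `exp (c * √(n / m))`;
this is where `α < 1 / 3` matters. -/
lemma eventually_rpow_mul_log_add_le {α c : ℝ} (hα1 : α < 1 / 3) (hc : 0 < c) :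
    ∀ᶠ n : ℕ in Filter.atTop, (n : ℝ) ^ α * Real.log (2 * n) + Real.log 8 ≤
      c * (n : ℝ) ^ ((1 - α) / 2) := by
  set s : ℝ := (1 - α) / 2 - α with hs
  have hs0 : 0 < s := by linarith
  have h1 : ∀ᶠ x : ℝ in Filter.atTop, Real.log x ≤ c / 4 * x ^ s := by
    filter_upwards [(isLittleO_log_rpow_atTop hs0).def (by positivity : 0 < c / 4),
      Filter.eventually_ge_atTop 0] with x hx hx0
    rw [Real.norm_eq_abs, Real.norm_eq_abs, abs_of_nonneg (Real.rpow_nonneg hx0 s)] at hx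
    exact (le_abs_self _).trans hx
  have h2 : ∀ᶠ x : ℝ in Filter.atTop, Real.log 8 / (c / 2) ≤ x ^ ((1 - α) / 2) :=
    (tendsto_rpow_atTop (by linarith)).eventually_ge_atTop _
  filter_upwards [tendsto_natCast_atTop_atTop.eventually h1,
    tendsto_natCast_atTop_atTop.eventually h2, Filter.eventually_ge_atTop 2] with n hn1 hn2 hn
  have hn' : (2 : ℝ) ≤ n := by exact_mod_cast hn
  have hn0 : (0 : ℝ) < n := by linarith
  rw [div_le_iff₀ (by positivity)] at hn2
  have hlog : Real.log (2 * n) ≤ 2 * (c / 4 * (n : ℝ) ^ s) := by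
    rw [Real.log_mul (by norm_num) hn0.ne']
    linarith [Real.log_le_log (by norm_num) hn']
  calc (n : ℝ) ^ α * Real.log (2 * n) + Real.log 8
      ≤ (n : ℝ) ^ α * (2 * (c / 4 * (n : ℝ) ^ s)) + (n : ℝ) ^ ((1 - α) / 2) * (c / 2) := by
        gcongr
    _ = c / 2 * ((n : ℝ) ^ α * (n : ℝ) ^ s) + (n : ℝ) ^ ((1 - α) / 2) * (c / 2) := by ring
    _ = c * (n : ℝ) ^ ((1 - α) / 2) := by
        rw [← Real.rpow_add hn0, hs, add_sub_cancel]
        ring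

/-! ### The moment bound -/

theorem theorem1
    -- the law of the weights: non-degenerate, non-negative, bounded
    (μ : Measure ℝ) [IsProbabilityMeasure μ]
    (hnondeg : ∀ a : ℝ, μ ≠ Measure.dirac a)
    (hnonneg : μ (Set.Iio 0) = 0)
    (hbdd : ∃ C : ℝ, 0 < C ∧ μ (Set.Iic C) = 1)
    (α : ℝ) (hα0 : 0 < α) (hα1 : α < 1 / 3)
    (r : ℝ) (hr : 1 ≤ r) :
    ∃ c₀ : ℝ, 0 < c₀ ∧ ∃ N : ℕ, ∀ n : ℕ, N ≤ n →
      -- i.i.d. weights with law `μ` on the `n × ⌊n ^ α⌋` grid, on any probability space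
      ∀ (Ω : Type*) [MeasurableSpace Ω] (P : Measure Ω) [IsProbabilityMeasure P]
        (w : Grid n ⌊(n : ℝ) ^ α⌋₊ → Ω → ℝ),
        (∀ v, HasLaw (w v) μ P) → iIndepFun w P →
          c₀ * (n : ℝ) ^ (r * (1 - α) / 2) ≤
            absCentralMoment (fun ω => lastPassageTime (fun v => w v ω)) r P := by
  obtain ⟨γ, hγ0, hγ1, hγ⟩ := exists_lintegral_exp_neg_gain_le μ hnondeg
  obtain ⟨C, hC0, hC⟩ := hbdd
  obtain ⟨N, hN⟩ := Filter.eventually_atTop.1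
    ((eventually_rpow_mul_log_add_le hα1 (half_pos hγ0)).and (Filter.eventually_ge_atTop 1))
  refine ⟨(γ / 4) ^ r / 40, by positivity, N, fun n hNn Ω _ P _ => ?_⟩
  obtain ⟨hasymp, hn⟩ := hN n hNn
  set m := ⌊(n : ℝ) ^ α⌋₊
  intro w hw hind
  have hn1 : (1 : ℝ) ≤ n := by exact_mod_cast hn
  have hn0 : (0 : ℝ) < n := by linarith
  have hm : 1 ≤ m := Nat.le_floor (by simpa using Real.one_le_rpow hn1 hα0.le)
  have hmα : (m : ℝ) ≤ (n : ℝ) ^ α := Nat.floor_le (by positivity)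
  have hmn : (m : ℝ) ≤ n := hmα.trans
    (by simpa using Real.rpow_le_rpow_of_exponent_le hn1 (by linarith : α ≤ 1))
  set q : ℝ := (n : ℝ) ^ ((1 - α) / 2) with hq
  set e : ℝ := (√((n * m : ℕ) : ℝ))⁻¹ with he
  have hnm : (1 : ℝ) ≤ (n * m : ℕ) := by exact_mod_cast Nat.mul_pos hn hm
  have he0 : 0 ≤ e := by positivity
  have he1 : e ≤ 1 := inv_le_one_of_one_le₀ (Real.one_le_sqrt.2 hnm)
  have he2 : e ^ 2 * (n * m : ℕ) ≤ 1 := by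
    rw [he, inv_pow, Real.sq_sqrt (by positivity), inv_mul_cancel₀ (by positivity)]
  have hqe : q ≤ e * (n + m - 1 : ℕ) := by
    have hle : (n : ℝ) ≤ (n + m - 1 : ℕ) := by exact_mod_cast (by lia : n ≤ n + m - 1)
    have hsqrt : √((n * m : ℕ) : ℝ) ≤ (n : ℝ) ^ ((1 + α) / 2) := by
      rw [Real.sqrt_le_left (by positivity), ← Real.rpow_natCast, ← Real.rpow_mul hn0.le]
      calc ((n * m : ℕ) : ℝ) = n * m := by push_cast; rfl
        _ ≤ (n : ℝ) ^ (1 : ℝ) * (n : ℝ) ^ α := by rw [Real.rpow_one]; gcongr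
        _ = (n : ℝ) ^ ((1 + α) / 2 * ((2 : ℕ) : ℝ)) := by
          rw [← Real.rpow_add hn0]
          congr 1
          push_cast
          ring
    rw [he, inv_mul_eq_div, le_div_iff₀ (by positivity)]
    calc q * √((n * m : ℕ) : ℝ) ≤ q * (n : ℝ) ^ ((1 + α) / 2) := by gcongr
      _ = n := by
        rw [hq, ← Real.rpow_add hn0]
        ring_nf
        exact Real.rpow_one _
      _ ≤ _ := hle
  have hpaths : ((n + m : ℕ) : ℝ) ^ m * Real.exp (-(e * γ * (n + m - 1 : ℕ) / 2)) ≤ 1 / 8 := by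
    calc ((n + m : ℕ) : ℝ) ^ m * Real.exp (-(e * γ * (n + m - 1 : ℕ) / 2))
        ≤ (2 * n : ℝ) ^ m * Real.exp (-(γ / 2 * q)) := by
          gcongr
          · push_cast
            linarith
          · nlinarith
      _ = Real.exp (m * Real.log (2 * n) - γ / 2 * q) := by
          rw [sub_eq_add_neg, Real.exp_add, Real.exp_nat_mul, Real.exp_log (by positivity)]
      _ ≤ Real.exp (-Real.log 8) := by
          refine Real.exp_le_exp.2 ?_
          have : (m : ℝ) * Real.log (2 * n) ≤ (n : ℝ) ^ α * Real.log (2 * n) := by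
            have := Real.log_nonneg (by linarith : (1 : ℝ) ≤ 2 * n)
            gcongr
          linarith
      _ = 1 / 8 := by
          rw [Real.exp_neg, Real.exp_log (by norm_num)]
          norm_num
  set W : Ω → Grid n m → ℝ := fun ω v => w v ω
  have hlaw : HasLaw W (Measure.pi fun _ => μ) P := hind.hasLaw_pi hw
  have hLm : AEMeasurable (fun ω => lastPassageTime (W ω)) P :=
    (measurable_lastPassageTime n m).comp_aemeasurable hlaw.aemeasurable
  set a := ∫ ω, lastPassageTime (W ω) ∂P
  have hprob : 1 / 40 ≤ P.real {ω | γ / 4 * q ≤ |lastPassageTime (W ω) - a|} := by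
    refine (measure_abs_lastPassageTime_sub_ge μ hnonneg hγ0 hγ1 hγ hn hm he0 he1 he2 hpaths
      (t := γ / 4 * q) (by nlinarith) a).trans_eq ?_
    rw [measureReal_def, measureReal_def, ← hlaw.map_eq, Measure.map_apply_of_aemeasurable
      hlaw.aemeasurable (measurableSet_le measurable_const
        ((measurable_lastPassageTime n m).sub_const a).abs)]
    rfl
  -- Boundedness of the weights makes the moment finite, so that the integral is not a junk value.
  have hbound : ∀ᵐ ω ∂P, |lastPassageTime (W ω)| ≤ (n + m - 1 : ℕ) * C := by
    have hμ : ∀ᵐ x ∂μ, |x| ≤ C := by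
      have h1 : ∀ᵐ x ∂μ, x ∈ Set.Iic C := (mem_ae_iff_prob_eq_one measurableSet_Iic).2 hC
      have h2 : ∀ᵐ x ∂μ, x ∉ Set.Iio 0 := measure_eq_zero_iff_ae_notMem.1 hnonneg
      filter_upwards [h1, h2] with x hx1 hx2
      rw [abs_of_nonneg (not_lt.1 hx2)]
      exact hx1
    have hall : ∀ᵐ ω ∂P, ∀ v, |w v ω| ≤ C := by
      refine ae_all_iff.2 fun v => ?_
      rw [← (hw v).map_eq] at hμ
      exact ae_of_ae_map (hw v).aemeasurable hμ
    exact hall.mono fun ω hω => abs_lastPassageTime_le hn hm hω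
  have hint : Integrable (fun ω => |lastPassageTime (W ω) - a| ^ r) P := by
    refine Integrable.of_bound ((hLm.sub_const a).abs.pow_const r).aestronglyMeasurable
      (((n + m - 1 : ℕ) * C + |a|) ^ r) (hbound.mono fun ω hω => ?_)
    rw [Real.norm_of_nonneg (by positivity)]
    gcongr
    exact (abs_sub _ _).trans (by gcongr)
  calc (γ / 4) ^ r / 40 * (n : ℝ) ^ (r * (1 - α) / 2)
      = (γ / 4 * q) ^ r * (1 / 40) := by
        rw [Real.mul_rpow (by positivity) (by positivity), hq, ← Real.rpow_mul hn0.le,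
          mul_div_assoc, mul_comm r]
        ring
    _ ≤ (γ / 4 * q) ^ r * P.real {ω | γ / 4 * q ≤ |lastPassageTime (W ω) - a|} := by gcongr
    _ ≤ (γ / 4 * q) ^ r *
          P.real {ω | (γ / 4 * q) ^ r ≤ |lastPassageTime (W ω) - a| ^ r} := by
        refine mul_le_mul_of_nonneg_left (measureReal_mono (fun ω hω => ?_)) (by positivity)
        exact Real.rpow_le_rpow (by positivity) hω (by linarith)
    _ ≤ ∫ ω, |lastPassageTime (W ω) - a| ^ r ∂P :=
        mul_meas_ge_le_integral_of_nonneg (.of_forall fun ω => by positivity) hint _
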